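/- Let $\alpha>0$ and let $d\lambda_\alpha(w)=\frac{\alpha}{\pi}e^{-\alpha|w|^2}\,dA(w)$ be the Gaussian measure on $\mathbb{C}$, where $dA$ is Lebesgue area measure. Let $F_\alpha^2$ be the Fock space of entire functions in $L^2(\mathbb{C},d\lambda_\alpha)$, with inner product $\langle f,g\rangle=\int_{\mathbb{C}} f\overline{g}\,d\lambda_\alpha$ and orthonormal basis $e_n(w)=\sqrt{\alpha^n/n!}\,w^n$ ($n\ge 0$), and let $P:L^2(\mathbb{C},d\lambda_\alpha)\to F_\alpha^2$ be the orthogonal projection. Let $K:F_\alpha^2\to L^2(\mathbb{C},d\lambda_\alpha)$ be the bounded linear operator with $K e_{2n}=e_n$ and $K e_{2n+1}=\overline{e_{n+1}}$ for all $n\ge 0$. For $z\in\mathbb{C}$ let $K_z(w)=e^{\alpha\overline{z}w}$ be the reproducing kernel of $F_\alpha^2$, let $k_z=K_z/\|K_z\|$, and put $I(z,w)=K(k_z)(w)$. For $\phi\in L^\infty(\mathbb{C})$ let $S_\phi:F_\alpha^2\to F_\alpha^2$, $S_\phi f=P(\phi\,K f)$, be the H-Toeplitz operator with symbol $\phi$,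 and let $\widetilde{S_\phi}(z)=\langle S_\phi k_z,k_z\rangle$ be its Berezin transform. Then for every $\phi\in L^\infty(\mathbb{C})$ and every $z\in\mathbb{C}$, the function $w\mapsto\phi(w)I(z,w)e^{\alpha z\overline{w}}$ is $\lambda_\alpha$-integrable and $$\widetilde{S_\phi}(z)=e^{-\frac{\alpha|z|^2}{2}}\int_{\mathbb{C}}\phi(w)\,I(z,w)\,e^{\alpha z\overline{w}}\,d\lambda_\alpha(w).$$ Moreover, $\widetilde{S_\phi}(z)\to 0$ as $|z|\to\infty$. -/

import Mathlib

open MeasureTheory Filter Topology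
open scoped ENNReal ComplexConjugate

noncomputable section

namespace HToeplitz

/-- The density of the Gaussian measure with respect to the Lebesgue area measure. -/
def gaussianDensity (α : ℝ) (z : ℂ) : ℝ := α / Real.pi * Real.exp (-α * ‖z‖ ^ 2)

/-- The Gaussian measure `dλ_α(z) = (α / π) e^{-α |z|²} dA(z)` on `ℂ`. -/
def gaussianMeasure (α : ℝ) : Measure ℂ :=
  volume.withDensity fun z => ENNReal.ofReal (gaussianDensity α z)

theorem continuous_gaussianDensity (α : ℝ) : Continuous (gaussianDensity α) := by
  unfold gaussianDensity; fun_prop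

theorem gaussianDensity_pos {α : ℝ} (hα : 0 < α) (z : ℂ) : 0 < gaussianDensity α z := by
  unfold gaussianDensity; positivity

theorem gaussianMeasure_ac (α : ℝ) : gaussianMeasure α ≪ volume :=
  withDensity_absolutelyContinuous _ _

theorem ac_gaussianMeasure {α : ℝ} (hα : 0 < α) : volume ≪ gaussianMeasure α :=
  withDensity_absolutelyContinuous'
    (continuous_gaussianDensity α).measurable.ennreal_ofReal.aemeasurable
    (ae_of_all _ fun z => (ENNReal.ofReal_pos.2 (gaussianDensity_pos hα z)).ne')

theorem integral_gaussianMeasure {α : ℝ} (hα : 0 < α) (f : ℂ → ℂ) :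
    ∫ z, f z ∂gaussianMeasure α = ∫ z, gaussianDensity α z • f z := by
  unfold gaussianMeasure
  rw [integral_withDensity_eq_integral_toReal_smul
    (continuous_gaussianDensity α).measurable.ennreal_ofReal (by simp)]
  simp [ENNReal.toReal_ofReal (gaussianDensity_pos hα _).le]

theorem integrable_gaussianMeasure_iff {α : ℝ} (hα : 0 < α) {E : Type*} [NormedAddCommGroup E]
    [NormedSpace ℝ E] (f : ℂ → E) :
    Integrable f (gaussianMeasure α) ↔ Integrable fun z => gaussianDensity α z • f z := by
  unfold gaussianMeasure
  rw [integrable_withDensity_iff_integrable_smul'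
    (continuous_gaussianDensity α).measurable.ennreal_ofReal (by simp)]
  simp [ENNReal.toReal_ofReal (gaussianDensity_pos hα _).le]

theorem memLp_of_le_exp {α : ℝ} (hα : 0 < α) {f : ℂ → ℂ} (hf : Continuous f) {C c : ℝ}
    (h : ∀ z, ‖f z‖ ≤ C * Real.exp (c * ‖z‖)) : MemLp f 2 (gaussianMeasure α) := by
  rw [memLp_two_iff_integrable_sq_norm hf.aestronglyMeasurable,
    integrable_gaussianMeasure_iff hα]
  have h0 : Integrable fun z : ℂ =>
      α / Real.pi * C ^ 2 * Real.exp (2 * c ^ 2 / α) * Real.exp (-(α / 2) * ‖z‖ ^ 2) := by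
    have := (GaussianFourier.integrable_cexp_neg_mul_sq_norm_add (b := ((α / 2 : ℝ) : ℂ))
      (V := ℂ) (by simpa using hα) 0 0).norm
    refine (this.congr (ae_of_all _ fun z => ?_)).const_mul _
    simp only [zero_mul, add_zero, Complex.norm_exp]
    congr 1
    norm_cast
  refine h0.mono' (((continuous_gaussianDensity α).smul (hf.norm.pow 2)).aestronglyMeasurable)
    (ae_of_all _ fun z => ?_)
  rw [smul_eq_mul, Real.norm_of_nonneg (mul_nonneg (gaussianDensity_pos hα z).le (sq_nonneg _))]
  have h1 : ‖f z‖ ^ 2 ≤ (C * Real.exp (c * ‖z‖)) ^ 2 :=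
    pow_le_pow_left₀ (norm_nonneg _) (h z) 2
  have h2 : Real.exp (-α * ‖z‖ ^ 2) * Real.exp (c * ‖z‖) ^ 2
      ≤ Real.exp (2 * c ^ 2 / α) * Real.exp (-(α / 2) * ‖z‖ ^ 2) := by
    rw [← Real.exp_nat_mul, ← Real.exp_add, ← Real.exp_add]
    apply Real.exp_le_exp.2
    have : 2 * c ^ 2 / α + -(α / 2) * ‖z‖ ^ 2 - (-α * ‖z‖ ^ 2 + (2 : ℕ) * (c * ‖z‖))
        = (2 * c - α * ‖z‖) ^ 2 / (2 * α) := by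
      field_simp; push_cast; ring
    have h3 : 0 ≤ (2 * c - α * ‖z‖) ^ 2 / (2 * α) := by positivity
    linarith
  calc gaussianDensity α z * ‖f z‖ ^ 2
      ≤ gaussianDensity α z * (C * Real.exp (c * ‖z‖)) ^ 2 :=
        mul_le_mul_of_nonneg_left h1 (gaussianDensity_pos hα z).le
    _ = α / Real.pi * C ^ 2 * (Real.exp (-α * ‖z‖ ^ 2) * Real.exp (c * ‖z‖) ^ 2) := by
        unfold gaussianDensity; ring
    _ ≤ α / Real.pi * C ^ 2 * (Real.exp (2 * c ^ 2 / α) * Real.exp (-(α / 2) * ‖z‖ ^ 2)) :=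
        mul_le_mul_of_nonneg_left h2 (by positivity)
    _ = _ := by ring

/-- The function `e_n(z) = √(α^n / n!) z^n`. -/
def monomialFun (α : ℝ) (n : ℕ) (z : ℂ) : ℂ := (Real.sqrt (α ^ n / n.factorial) : ℂ) * z ^ n

/-- The reproducing kernel `K_z(w) = e^{α \bar z w}`. -/
def kernelFun (α : ℝ) (z w : ℂ) : ℂ := Complex.exp (α * conj z * w)

theorem differentiable_monomialFun (α : ℝ) (n : ℕ) : Differentiable ℂ (monomialFun α n) := by
  unfold monomialFun; fun_prop

theorem differentiable_kernelFun (α : ℝ) (z : ℂ) : Differentiable ℂ (kernelFun α z) := by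
  unfold kernelFun; fun_prop

theorem norm_pow_le_exp (n : ℕ) (z : ℂ) : ‖z‖ ^ n ≤ n.factorial * Real.exp (1 * ‖z‖) := by
  have := Real.pow_div_factorial_le_exp ‖z‖ (norm_nonneg z) n
  rw [one_mul]
  rwa [div_le_iff₀' (by positivity)] at this

theorem memLp_pow {α : ℝ} (hα : 0 < α) (n : ℕ) :
    MemLp (fun z : ℂ => z ^ n) 2 (gaussianMeasure α) :=
  memLp_of_le_exp hα (by fun_prop) (C := n.factorial)
    (fun z => by rw [norm_pow]; exact norm_pow_le_exp n z)

theorem memLp_monomialFun {α : ℝ} (hα : 0 < α) (n : ℕ) :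
    MemLp (monomialFun α n) 2 (gaussianMeasure α) :=
  (memLp_pow hα n).const_mul _

theorem memLp_kernelFun {α : ℝ} (hα : 0 < α) (z : ℂ) :
    MemLp (kernelFun α z) 2 (gaussianMeasure α) := by
  refine memLp_of_le_exp hα (differentiable_kernelFun α z).continuous (C := 1) (c := α * ‖z‖)
    fun w => ?_
  rw [kernelFun, one_mul]
  refine (Complex.norm_exp_le_exp_norm _).trans (le_of_eq ?_)
  simp [abs_of_pos hα]

/-- The Fock space `F_α²`, as a subspace of `L²(ℂ, dλ_α)`: the classes of those entire functions
that are square integrable with respect to `λ_α`. -/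
def fockSpace (α : ℝ) : Submodule ℂ (Lp ℂ 2 (gaussianMeasure α)) where
  carrier := {f | ∃ g : ℂ → ℂ, Differentiable ℂ g ∧ f =ᵐ[gaussianMeasure α] g}
  add_mem' := by
    rintro f₁ f₂ ⟨g₁, hg₁, h₁⟩ ⟨g₂, hg₂, h₂⟩
    refine ⟨g₁ + g₂, hg₁.add hg₂, ?_⟩
    filter_upwards [Lp.coeFn_add f₁ f₂, h₁, h₂] with z hz h₁ h₂
    rw [hz, Pi.add_apply, Pi.add_apply, h₁, h₂]
  zero_mem' := ⟨0, differentiable_const 0, Lp.coeFn_zero _ _ _⟩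
  smul_mem' := by
    rintro c f ⟨g, hg, h⟩
    refine ⟨c • g, hg.const_smul c, ?_⟩
    filter_upwards [Lp.coeFn_smul c f, h] with z hz h
    simp [hz, h]

theorem toLp_mem_fockSpace {α : ℝ} {g : ℂ → ℂ} (hg : Differentiable ℂ g)
    (h : MemLp g 2 (gaussianMeasure α)) : h.toLp g ∈ fockSpace α :=
  ⟨g, hg, h.coeFn_toLp⟩

section Rotation

theorem integral_rotate {α : ℝ} (hα : 0 < α) (u : Circle) (h : ℂ → ℂ) :
    ∫ z, h (u * z) ∂gaussianMeasure α = ∫ z, h z ∂gaussianMeasure α := by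
  rw [integral_gaussianMeasure hα, integral_gaussianMeasure hα]
  have := (rotation u).measurePreserving.integral_comp
    (rotation u).toHomeomorph.measurableEmbedding (fun z => gaussianDensity α z • h z)
  rw [← this]
  simp [gaussianDensity, Circle.norm_coe]

theorem integrable_rotate {α : ℝ} (hα : 0 < α) (u : Circle) {h : ℂ → ℂ}
    (hh : Integrable h (gaussianMeasure α)) :
    Integrable (fun z => h (u * z)) (gaussianMeasure α) := by
  rw [integrable_gaussianMeasure_iff hα] at hh ⊢
  have := (rotation u).measurePreserving.integrable_comp_of_integrable hh
  refine this.congr (ae_of_all _ fun z => ?_)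
  simp [gaussianDensity, Circle.norm_coe]

instance (α : ℝ) : SFinite (gaussianMeasure α) := by unfold gaussianMeasure; infer_instance

theorem integral_circle {g : ℂ → ℂ} (hg : Differentiable ℂ g) (n : ℕ) (z : ℂ) :
    ∫ θ in (0 : ℝ)..2 * Real.pi, conj (Complex.exp (θ * Complex.I) * z) ^ n *
      g (Complex.exp (θ * Complex.I) * z)
      = 2 * Real.pi * (iteratedDeriv n g 0 / n.factorial) * (‖z‖ ^ (2 * n) : ℝ) := by
  have hG : Differentiable ℂ fun ζ => g (z * ζ) := by fun_prop
  have h1 := DiffContOnCl.circleIntegral_one_div_sub_center_pow_smul (R := 1) (c := 0)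
    one_pos n (hG.diffContOnCl)
  rw [iteratedDeriv_comp_const_mul hg.contDiff] at h1
  simp only [circleIntegral, deriv_circleMap, smul_eq_mul, sub_zero, mul_zero] at h1
  have h2 : ∀ θ : ℝ, conj (Complex.exp (θ * Complex.I) * z) ^ n *
      g (Complex.exp (θ * Complex.I) * z) = conj z ^ n * (-Complex.I) *
      (circleMap 0 1 θ * Complex.I * (1 / circleMap 0 1 θ ^ (n + 1) * g (z * circleMap 0 1 θ))) := by
    intro θ
    have h3 : conj (Complex.exp (θ * Complex.I)) * Complex.exp (θ * Complex.I) = 1 := by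
      rw [← Complex.exp_conj, ← Complex.exp_add]; simp
    have h4 := Complex.exp_ne_zero (θ * Complex.I)
    have h5 : conj (Complex.exp (θ * Complex.I)) = 1 / Complex.exp (θ * Complex.I) := by
      field_simp; exact h3
    simp only [circleMap, Complex.ofReal_one, one_mul, zero_add, map_mul, h5]
    rw [mul_comm z (Complex.exp _)]
    generalize Complex.exp (θ * Complex.I) = E at h4
    simp only [mul_pow, one_div, inv_pow, pow_succ]
    field_simp
    linear_combination (conj z ^ n * g (E * z)) * Complex.I_sq
  simp_rw [h2]
  rw [intervalIntegral.integral_const_mul, h1]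
  have h6 : conj z ^ n * z ^ n = ((‖z‖ ^ (2 * n) : ℝ) : ℂ) := by
    rw [← mul_pow, mul_comm, Complex.mul_conj, Complex.normSq_eq_norm_sq, pow_mul]; push_cast; rfl
  rw [← h6]
  linear_combination (-(conj z ^ n * z ^ n * 2 * Real.pi * iteratedDeriv n g 0 / n.factorial))
    * Complex.I_sq

theorem integral_conj_pow_mul {α : ℝ} (hα : 0 < α) {g : ℂ → ℂ} (hg : Differentiable ℂ g) (n : ℕ)
    (hi : Integrable (fun z => conj z ^ n * g z) (gaussianMeasure α)) :
    ∫ z, conj z ^ n * g z ∂gaussianMeasure α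
      = iteratedDeriv n g 0 / n.factorial * (n.factorial / α ^ n : ℝ) := by
  set h : ℂ → ℂ := fun z => conj z ^ n * g z with hh
  have hc : Continuous h := by
    have := hg.continuous
    rw [hh]; fun_prop
  set e : ℝ → Circle := fun θ => Circle.exp θ
  have he : ∀ θ : ℝ, (e θ : ℂ) = Complex.exp (θ * Complex.I) := fun θ => Circle.coe_exp θ
  have hpi : (0 : ℝ) ≤ 2 * Real.pi := by positivity
  have hint : Integrable (Function.uncurry fun (θ : ℝ) (z : ℂ) => h (e θ * z))
      ((volume.restrict (Set.Ioc 0 (2 * Real.pi))).prod (gaussianMeasure α)) := by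
    rw [integrable_prod_iff]
    · refine ⟨ae_of_all _ fun θ => integrable_rotate hα (e θ) hi, ?_⟩
      have : ∀ θ : ℝ, ∫ z, ‖Function.uncurry (fun (θ : ℝ) (z : ℂ) => h (e θ * z)) (θ, z)‖
          ∂gaussianMeasure α = ∫ z, ‖h z‖ ∂gaussianMeasure α := by
        intro θ
        have := integral_rotate hα (e θ) fun z => ((‖h z‖ : ℝ) : ℂ)
        rw [integral_complex_ofReal, integral_complex_ofReal] at this
        exact_mod_cast this
      simp_rw [this]
      exact integrable_const _
    · refine Continuous.aestronglyMeasurable ?_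
      have : Continuous fun p : ℝ × ℂ => h (Complex.exp (p.1 * Complex.I) * p.2) := by fun_prop
      simpa [Function.uncurry, he] using! this
  have h1 := integral_integral_swap hint
  simp_rw [integral_rotate hα] at h1
  simp only [← intervalIntegral.integral_of_le hpi, he, hh, integral_circle hg] at h1
  rw [intervalIntegral.integral_const, integral_const_mul, integral_complex_ofReal] at h1
  have hM : ∫ z : ℂ, ‖z‖ ^ (2 * n) ∂gaussianMeasure α = n.factorial / α ^ n := by
    have h2 := integral_gaussianMeasure hα fun z => ((‖z‖ ^ (2 * n) : ℝ) : ℂ)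
    rw [integral_complex_ofReal] at h2
    have h3 := Complex.integral_rpow_mul_exp_neg_mul_rpow (p := 2) (q := (2 * n : ℕ)) (b := α)
      (by norm_num) (by have : (0 : ℝ) ≤ (2 * n : ℕ) := by positivity
                        linarith) hα
    have h4 : ∫ z : ℂ, gaussianDensity α z • ((‖z‖ ^ (2 * n) : ℝ) : ℂ)
        = ((α / Real.pi * ∫ z : ℂ, ‖z‖ ^ ((2 * n : ℕ) : ℝ) * Real.exp (-α * ‖z‖ ^ (2 : ℝ)) : ℝ) : ℂ)
        := by
      rw [← integral_const_mul, ← integral_complex_ofReal]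
      congr 1
      ext z
      rw [Real.rpow_natCast, show (2 : ℝ) = (2 : ℕ) by norm_num, Real.rpow_natCast]
      simp only [gaussianDensity, Complex.real_smul]
      push_cast
      ring
    rw [h4, h3] at h2
    have h5 : ∫ z : ℂ, ‖z‖ ^ (2 * n) ∂gaussianMeasure α = _ := Complex.ofReal_injective h2
    rw [h5]
    have h6 : (((2 * n : ℕ) : ℝ) + 2) / 2 = n + 1 := by push_cast; ring
    rw [neg_div, h6, Real.Gamma_nat_eq_factorial, Real.rpow_neg hα.le,
      show (n : ℝ) + 1 = ((n + 1 : ℕ) : ℝ) by push_cast; ring, Real.rpow_natCast]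
    have := Real.pi_pos.ne'
    field_simp
    ring
  rw [hM, sub_zero, Complex.real_smul] at h1
  have hp : ((2 * Real.pi : ℝ) : ℂ) ≠ 0 := by
    exact_mod_cast (by positivity : (2 * Real.pi : ℝ) ≠ 0)
  apply mul_left_cancel₀ hp
  rw [h1]
  push_cast
  ring

end Rotation

theorem memLp_conj (α : ℝ) {f : ℂ → ℂ} (hf : MemLp f 2 (gaussianMeasure α)) :
    MemLp (fun z => conj (f z)) 2 (gaussianMeasure α) :=
  hf.star

theorem inner_toLp (α : ℝ) {f g : ℂ → ℂ} (hf : MemLp f 2 (gaussianMeasure α))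
    (hg : MemLp g 2 (gaussianMeasure α)) :
    inner ℂ (hf.toLp f) (hg.toLp g) = ∫ z, conj (f z) * g z ∂gaussianMeasure α := by
  rw [L2.inner_def]
  refine integral_congr_ae ?_
  filter_upwards [hf.coeFn_toLp, hg.coeFn_toLp] with z h1 h2
  rw [h1, h2, RCLike.inner_apply, mul_comm]

theorem integrable_conj_mul (α : ℝ) {f g : ℂ → ℂ} (hf : MemLp f 2 (gaussianMeasure α))
    (hg : MemLp g 2 (gaussianMeasure α)) :
    Integrable (fun z => conj (f z) * g z) (gaussianMeasure α) :=
  (memLp_conj α hf).integrable_mul hg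

section Basis

variable (α : ℝ) [hα : Fact (0 < α)]

/-- The vector `e_n` of the Fock space, `e_n(z) = √(α^n / n!) z^n`. -/
def basisVec (n : ℕ) : fockSpace α :=
  ⟨(memLp_monomialFun hα.out n).toLp _,
    toLp_mem_fockSpace (differentiable_monomialFun α n) (memLp_monomialFun hα.out n)⟩

/-- The vector `\overline{e_n}` of `L²(ℂ, dλ_α)`. -/
def conjBasisVec (n : ℕ) : Lp ℂ 2 (gaussianMeasure α) :=
  (memLp_conj α (memLp_monomialFun hα.out n)).toLp fun z => conj (monomialFun α n z)

/-- The image of the `n`-th basis vector under the dilation operator: `e_m` if `n = 2 m` is even,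
and `\overline{e_{m+1}}` if `n = 2 m + 1` is odd. -/
def dilationVec (n : ℕ) : Lp ℂ 2 (gaussianMeasure α) :=
  if Even n then (basisVec α (n / 2) : Lp ℂ 2 (gaussianMeasure α)) else conjBasisVec α (n / 2 + 1)

theorem integral_conj_pow_mul_pow (m n : ℕ) :
    ∫ z, conj z ^ m * z ^ n ∂gaussianMeasure α
      = if m = n then ((n.factorial / α ^ n : ℝ) : ℂ) else 0 := by
  have hi : Integrable (fun z : ℂ => conj z ^ m * z ^ n) (gaussianMeasure α) := by
    simpa using integrable_conj_mul α (memLp_pow hα.out m) (memLp_pow hα.out n)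
  rw [integral_conj_pow_mul hα.out (g := fun z => z ^ n) (by fun_prop) m hi, iteratedDeriv_pow]
  split_ifs with h
  · subst h
    have : (m.factorial : ℂ) ≠ 0 := by exact_mod_cast m.factorial_ne_zero
    simp [Nat.descFactorial_self, this]
  · rcases lt_or_gt_of_ne h with h | h
    · simp [zero_pow (Nat.sub_ne_zero_of_lt h)]
    · simp [Nat.descFactorial_of_lt h]

theorem integral_conj_monomialFun_mul (m n : ℕ) :
    ∫ z, conj (monomialFun α m z) * monomialFun α n z ∂gaussianMeasure α
      = if m = n then 1 else 0 := by
  have : ∀ z, conj (monomialFun α m z) * monomialFun α n z =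
      (Real.sqrt (α ^ m / m.factorial) : ℂ) * Real.sqrt (α ^ n / n.factorial) *
        (conj z ^ m * z ^ n) := by
    intro z; simp only [monomialFun, map_mul, map_pow, Complex.conj_ofReal]; ring
  simp_rw [this]
  rw [integral_const_mul, integral_conj_pow_mul_pow]
  split_ifs with h
  · subst h
    have hp := hα.out
    rw [← Complex.ofReal_mul, ← Complex.ofReal_mul, Real.mul_self_sqrt (by positivity)]
    norm_cast
    field_simp
  · simp

theorem orthonormal_basisVec : Orthonormal ℂ (basisVec α) := by
  rw [orthonormal_iff_ite]
  intro m n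
  rw [Submodule.coe_inner]
  exact (inner_toLp α (memLp_monomialFun hα.out m) (memLp_monomialFun hα.out n)).trans
    (integral_conj_monomialFun_mul α m n)

theorem inner_conjBasisVec (m n : ℕ) :
    inner ℂ (conjBasisVec α m) (conjBasisVec α n) = if m = n then 1 else 0 := by
  refine (inner_toLp α _ _).trans ?_
  have h := congrArg conj (integral_conj_monomialFun_mul α m n)
  rw [← integral_conj] at h
  simp only [map_mul] at h
  rw [h]; split_ifs <;> simp

theorem inner_basisVec_conjBasisVec (m n : ℕ) :
    inner ℂ (basisVec α m : Lp ℂ 2 (gaussianMeasure α)) (conjBasisVec α (n + 1)) = 0 := by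
  refine (inner_toLp α (memLp_monomialFun hα.out m)
    (memLp_conj α (memLp_monomialFun hα.out (n + 1)))).trans ?_
  have h := integral_conj_pow_mul_pow α 0 (m + (n + 1))
  rw [if_neg (by omega)] at h
  have h' := congrArg conj h
  rw [← integral_conj, map_zero] at h'
  have : ∀ z, conj (monomialFun α m z) * conj (monomialFun α (n + 1) z) =
      (Real.sqrt (α ^ m / m.factorial) : ℂ) * Real.sqrt (α ^ (n + 1) / (n + 1).factorial) *
        conj (conj z ^ 0 * z ^ (m + (n + 1))) := by
    intro z
    simp only [monomialFun, map_mul, map_pow, Complex.conj_ofReal, pow_zero, one_mul]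
    ring
  simp_rw [this]
  rw [integral_const_mul, h', mul_zero]

theorem orthonormal_dilationVec : Orthonormal ℂ (dilationVec α) := by
  rw [orthonormal_iff_ite]
  intro m n
  have hb := orthonormal_iff_ite.1 (orthonormal_basisVec α)
  unfold dilationVec
  by_cases h1 : Even m <;> by_cases h2 : Even n <;> simp only [h1, h2, if_true, if_false]
  · refine (hb _ _).trans (if_congr ?_ rfl rfl)
    rw [Nat.even_iff] at h1 h2; omega
  · rw [if_neg (by rintro rfl; exact h2 h1)]
    exact inner_basisVec_conjBasisVec α _ _
  · rw [if_neg (by rintro rfl; exact h1 h2), ← inner_conj_symm, inner_basisVec_conjBasisVec, map_zero]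
  · rw [inner_conjBasisVec]
    refine if_congr ?_ rfl rfl
    rw [Nat.even_iff] at h1 h2; omega

/-- A square summable combination of the `e_n` is an entire function. -/
theorem closure_span_le : (Submodule.span ℂ (Set.range fun n =>
    (basisVec α n : Lp ℂ 2 (gaussianMeasure α)))).topologicalClosure ≤ fockSpace α := by
  have hv : Orthonormal ℂ fun n => (basisVec α n : Lp ℂ 2 (gaussianMeasure α)) :=
    (orthonormal_basisVec α).comp_linearIsometry (fockSpace α).subtypeₗᵢ
  intro f hf
  have hf' : f ∈ LinearMap.range hv.orthogonalFamily.linearIsometry.toLinearMap := by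
    rw [hv.orthogonalFamily.range_linearIsometry]
    convert! hf using 2
    rw [Submodule.span_range_eq_iSup]
    simp_rw [← LinearMap.range_toSpanSingleton]
    rfl
  obtain ⟨c, rfl⟩ := hf'
  have hs := hv.orthogonalFamily.hasSum_linearIsometry c
  set f := hv.orthogonalFamily.linearIsometry c
  have hp := hα.out
  have hc : Summable fun n => ‖c n‖ ^ 2 := by
    simpa using (lp.memℓp c).summable (by norm_num)
  have hb : ∀ R : ℝ, ∀ n : ℕ, ∀ z ∈ Metric.ball (0 : ℂ) R,
      ‖c n * monomialFun α n z‖ ≤ ‖c n‖ ^ 2 + (α * R ^ 2) ^ n / n.factorial := by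
    intro R n z hz
    have hz : ‖z‖ < R := by simpa using hz
    have h1 : ‖monomialFun α n z‖ ^ 2 = (α * ‖z‖ ^ 2) ^ n / n.factorial := by
      simp only [monomialFun, norm_mul, norm_pow, Complex.norm_real, mul_pow]
      rw [Real.norm_of_nonneg (Real.sqrt_nonneg _), Real.sq_sqrt (by positivity)]
      ring
    have h2 : (α * ‖z‖ ^ 2) ^ n / n.factorial ≤ (α * R ^ 2) ^ n / n.factorial := by
      gcongr
    rw [norm_mul]
    nlinarith [sq_nonneg (‖c n‖ - ‖monomialFun α n z‖), sq_nonneg ‖c n‖,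
      sq_nonneg ‖monomialFun α n z‖]
  have hsum : ∀ R : ℝ, Summable fun n : ℕ => ‖c n‖ ^ 2 + (α * R ^ 2) ^ n / n.factorial :=
    fun R => hc.add (Real.summable_pow_div_factorial _)
  have hg : Differentiable ℂ fun z => ∑' n, c n * monomialFun α n z := by
    intro z
    refine (Complex.differentiableOn_tsum_of_summable_norm (hsum (‖z‖ + 1))
      (fun n => ((differentiable_monomialFun α n).const_mul _).differentiableOn)
      Metric.isOpen_ball (hb _)).differentiableAt (Metric.isOpen_ball.mem_nhds ?_)
    simp
  refine ⟨_, hg, ?_⟩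
  have ht := (tendstoInMeasure_of_tendsto_Lp hs.tendsto_sum_nat).exists_seq_tendsto_ae
  obtain ⟨ns, hns, hae⟩ := ht
  have hcoe : ∀ᵐ z ∂gaussianMeasure α, ∀ N : ℕ,
      (∑ n ∈ Finset.range N, LinearIsometry.toSpanSingleton ℂ _ (hv.1 n) (c n) :
        Lp ℂ 2 (gaussianMeasure α)) z = ∑ n ∈ Finset.range N, c n * monomialFun α n z := by
    rw [ae_all_iff]
    intro N
    induction N with
    | zero =>
      filter_upwards [Lp.coeFn_zero ℂ 2 (gaussianMeasure α)] with z hz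
      simpa using hz
    | succ N ih =>
      simp only [Finset.sum_range_succ]
      filter_upwards [ih, Lp.coeFn_add (∑ n ∈ Finset.range N,
        LinearIsometry.toSpanSingleton ℂ _ (hv.1 n) (c n)) (LinearIsometry.toSpanSingleton ℂ _
          (hv.1 N) (c N)), Lp.coeFn_smul (c N) (basisVec α N : Lp ℂ 2 (gaussianMeasure α)),
          (memLp_monomialFun hα.out N).coeFn_toLp] with z h1 h2 h3 h4
      rw [h2, Pi.add_apply, h1]
      congr 1
      refine h3.trans ?_
      rw [Pi.smul_apply, smul_eq_mul]
      congr 1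
  filter_upwards [hae, hcoe] with z h1 h2
  simp only [h2] at h1
  have h3 : Summable fun n => c n * monomialFun α n z :=
    Summable.of_norm_bounded (hsum (‖z‖ + 1)) fun n => hb _ n z (by simp)
  exact tendsto_nhds_unique h1 (h3.hasSum.tendsto_sum_nat.comp hns.tendsto_atTop)

/-- An element of the Fock space that is orthogonal to every `e_n` vanishes. -/
theorem eq_zero_of_inner_basisVec {f : Lp ℂ 2 (gaussianMeasure α)} (hf : f ∈ fockSpace α)
    (h : ∀ n, inner ℂ (basisVec α n : Lp ℂ 2 (gaussianMeasure α)) f = 0) : f = 0 := by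
  obtain ⟨g, hg, hfg⟩ := hf
  have hgL : MemLp g 2 (gaussianMeasure α) := (memLp_congr_ae hfg).1 (Lp.memLp f)
  have hfe : f = hgL.toLp g := by
    apply Lp.ext
    exact hfg.trans hgL.coeFn_toLp.symm
  have hp := hα.out
  have hd : ∀ n, iteratedDeriv n g 0 = 0 := by
    intro n
    have h1 := h n
    rw [hfe] at h1
    have h2 := (inner_toLp α (memLp_monomialFun hα.out n) hgL).symm.trans h1
    have h3 : ∀ z, conj (monomialFun α n z) * g z =
        (Real.sqrt (α ^ n / n.factorial) : ℂ) * (conj z ^ n * g z) := by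
      intro z; simp only [monomialFun, map_mul, map_pow, Complex.conj_ofReal]; ring
    simp_rw [h3] at h2
    have hi : Integrable (fun z : ℂ => conj z ^ n * g z) (gaussianMeasure α) := by
      simpa using integrable_conj_mul α (memLp_pow hα.out n) hgL
    rw [integral_const_mul, integral_conj_pow_mul hα.out hg n hi] at h2
    have h4 : (Real.sqrt (α ^ n / n.factorial) : ℂ) ≠ 0 := by
      exact_mod_cast (Real.sqrt_pos.2 (by positivity)).ne'
    have h5 : ((n.factorial / α ^ n : ℝ) : ℂ) ≠ 0 := by
      exact_mod_cast (by positivity : (n.factorial / α ^ n : ℝ) ≠ 0)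
    have h6 : (n.factorial : ℂ) ≠ 0 := by exact_mod_cast n.factorial_ne_zero
    rcases mul_eq_zero.1 h2 with h7 | h7
    · exact absurd h7 h4
    · rcases mul_eq_zero.1 h7 with h8 | h8
      · exact (div_eq_zero_iff.1 h8).resolve_right h6
      · exact absurd h8 h5
  have h0 : g = 0 := by
    ext z
    rw [← Complex.taylorSeries_eq_of_entire' 0 z hg]
    simp [hd]
  rw [hfe]
  apply Lp.ext
  filter_upwards [hgL.coeFn_toLp, Lp.coeFn_zero ℂ 2 (gaussianMeasure α)] with z h1 h2
  rw [h1, h2, h0]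

theorem fockSpace_eq_closure : fockSpace α = (Submodule.span ℂ (Set.range fun n =>
    (basisVec α n : Lp ℂ 2 (gaussianMeasure α)))).topologicalClosure := by
  refine le_antisymm (fun f hf => ?_) (closure_span_le α)
  set V := (Submodule.span ℂ (Set.range fun n =>
    (basisVec α n : Lp ℂ 2 (gaussianMeasure α)))).topologicalClosure
  have : CompleteSpace V :=
    (Submodule.isClosed_topologicalClosure _).completeSpace_coe
  have h1 : f - V.starProjection f ∈ fockSpace α :=
    (fockSpace α).sub_mem hf (closure_span_le α (V.starProjection_apply_mem f))
  have h2 : f - V.starProjection f = 0 := by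
    refine eq_zero_of_inner_basisVec α h1 fun n => ?_
    exact (V.sub_starProjection_mem_orthogonal f) _
      (Submodule.le_topologicalClosure _ (Submodule.subset_span ⟨n, rfl⟩))
  rw [sub_eq_zero.1 h2]
  exact V.starProjection_apply_mem f

instance completeSpace_fockSpace : CompleteSpace (fockSpace α) := by
  rw [fockSpace_eq_closure]
  exact (Submodule.isClosed_topologicalClosure _).completeSpace_coe

/-- The orthonormal basis `(e_n)` of the Fock space. -/
def fockBasis : HilbertBasis ℕ ℂ (fockSpace α) :=
  HilbertBasis.mkOfOrthogonalEqBot (orthonormal_basisVec α) (by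
    rw [eq_bot_iff]
    intro f hf
    rw [Submodule.mem_bot, ← Submodule.coe_eq_zero]
    exact eq_zero_of_inner_basisVec α f.2 fun n =>
      hf _ (Submodule.subset_span ⟨n, rfl⟩))

theorem fockBasis_apply (n : ℕ) : fockBasis α n = basisVec α n := by
  simp [fockBasis]

/-- The dilation operator `K : F_α² → L²(ℂ, dλ_α)`, the isometry with `K e_{2n} = e_n` and
`K e_{2n+1} = \overline{e_{n+1}}`. -/
def dilation : fockSpace α →L[ℂ] Lp ℂ 2 (gaussianMeasure α) :=
  ((orthonormal_dilationVec α).orthogonalFamily.linearIsometry.comp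
    (fockBasis α).repr.toLinearIsometry).toContinuousLinearMap

theorem dilation_basisVec (n : ℕ) : dilation α (basisVec α n) = dilationVec α n := by
  rw [← fockBasis_apply]
  simp [dilation, HilbertBasis.repr_self]

theorem dilation_basisVec_even (n : ℕ) : dilation α (basisVec α (2 * n)) = basisVec α n := by
  rw [dilation_basisVec, dilationVec, if_pos (by simp)]
  simp

theorem dilation_basisVec_odd (n : ℕ) :
    dilation α (basisVec α (2 * n + 1)) = conjBasisVec α (n + 1) := by
  rw [dilation_basisVec, dilationVec, if_neg (by simp)]
  congr 2
  omega

end Basis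

section Operators

variable (α : ℝ)

theorem memLp_top_gaussian {φ : ℂ → ℂ} (hφ : MemLp φ ∞ volume) :
    MemLp φ ∞ (gaussianMeasure α) := by
  refine ⟨hφ.1.mono_ac (gaussianMeasure_ac α), ?_⟩
  have h := hφ.2
  rw [eLpNorm_exponent_top] at h ⊢
  exact (eLpNormEssSup_mono_measure φ (gaussianMeasure_ac α)).trans_lt h

/-- The operator `M_φ` of multiplication by `φ ∈ L^∞(ℂ)` on `L²(ℂ, dλ_α)`. -/
def mulOp (φ : ℂ → ℂ) (hφ : MemLp φ ∞ volume) :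
    Lp ℂ 2 (gaussianMeasure α) →L[ℂ] Lp ℂ 2 (gaussianMeasure α) :=
  (ContinuousLinearMap.mul ℂ ℂ).holderL (gaussianMeasure α) ∞ 2 2
    ((memLp_top_gaussian α hφ).toLp φ)

theorem coeFn_mulOp (φ : ℂ → ℂ) (hφ : MemLp φ ∞ volume) (f : Lp ℂ 2 (gaussianMeasure α)) :
    mulOp α φ hφ f =ᵐ[gaussianMeasure α] fun w => φ w * f w := by
  have h := (ContinuousLinearMap.mul ℂ ℂ).coeFn_holder (r := 2)
    ((memLp_top_gaussian α hφ).toLp φ) f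
  filter_upwards [h, (memLp_top_gaussian α hφ).coeFn_toLp] with w h1 h2
  refine h1.trans ?_
  rw [ContinuousLinearMap.mul_apply', h2]

variable [hα : Fact (0 < α)]

/-- The H-Toeplitz operator `S_φ = P M_φ K` on the Fock space, where `P` is the orthogonal
projection of `L²(ℂ, dλ_α)` onto the Fock space. -/
def hToeplitz (φ : ℂ → ℂ) (hφ : MemLp φ ∞ volume) : fockSpace α →L[ℂ] fockSpace α :=
  (fockSpace α).orthogonalProjectionOnto ∘L mulOp α φ hφ ∘L dilation α

/-- The reproducing kernel `K_z` as an element of the Fock space. -/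
def kernelVec (z : ℂ) : fockSpace α :=
  ⟨(memLp_kernelFun hα.out z).toLp _,
    toLp_mem_fockSpace (differentiable_kernelFun α z) (memLp_kernelFun hα.out z)⟩

/-- The normalized reproducing kernel `k_z = K_z / ‖K_z‖`. -/
def normKernelVec (z : ℂ) : fockSpace α := ((‖kernelVec α z‖ : ℂ))⁻¹ • kernelVec α z

/-- The Berezin transform `z ↦ ⟨T k_z, k_z⟩` of an operator `T`; Mathlib's inner product is
conjugate-linear in its first argument. -/
def berezin (T : fockSpace α →L[ℂ] fockSpace α) (z : ℂ) : ℂ :=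
  inner ℂ (normKernelVec α z) (T (normKernelVec α z))

/-- The kernel function `I(z, w) = K(k_z)(w)`. For each `z` this is an element of `L²(ℂ, dλ_α)`,
so it is determined for almost every `w`. -/
def dilatedKernel (z w : ℂ) : ℂ := dilation α (normKernelVec α z) w

end Operators

end HToeplitz

end

/-!
The product of the kernel `K_z` with `φ K K_z` is estimated by Cauchy–Schwarz in a weighted form:
the density of `λ_α` is, up to a constant, the geometric mean of the densities of `λ_β` and `λ_γ`
whenever `β + γ = 2 α`, so that `‖f g‖_{L¹(λ_α)} ≲ ‖f‖_{L²(λ_β)} ‖g‖_{L²(λ_γ)}`. Here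
`‖K_z‖² = exp (α² |z|² / β)` in `L²(λ_β)`, because `K_z` is a reproducing kernel for `β` as well.
The functions `K e_n` are orthogonal in every `L²(λ_γ)`, with `‖K e_n‖² = (α / γ) ^ ((n + 1) / 2)`:
`K` halves the degree, so a weight `γ = α / q²` costs only a factor of order `q ^ n`, and
`‖K K_z‖² ≤ q exp (q α |z|²)` in `L²(λ_γ)`. Hence the Berezin transform is bounded by a constant
times `exp (((α / β + q) / 2 - 1) α |z|²)`. At `q = 1` the rate is `0`, and its derivative in `q`
is negative there, so a slightly larger `q` gives Gaussian decay.
-/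

namespace HToeplitz

section GaussianMeasure

theorem eLpNorm_withDensity_ofReal {X E : Type*} [MeasurableSpace X] [NormedAddCommGroup E]
    [NormedSpace ℝ E] {μ : Measure X} {ρ : X → ℝ} (hρ : Measurable ρ) (hρ0 : ∀ x, 0 ≤ ρ x)
    (f : X → E) {p : ℝ≥0∞} (hp0 : p ≠ 0) (hp : p ≠ ∞) :
    eLpNorm f p (μ.withDensity fun x => ENNReal.ofReal (ρ x)) =
      eLpNorm (fun x => ρ x ^ (1 / p.toReal) • f x) p μ := by
  have hp_pos : 0 < p.toReal := ENNReal.toReal_pos hp0 hp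
  rw [eLpNorm_eq_lintegral_rpow_enorm_toReal hp0 hp, eLpNorm_eq_lintegral_rpow_enorm_toReal hp0 hp,
    lintegral_withDensity_eq_lintegral_mul_non_measurable₀ _ hρ.ennreal_ofReal.aemeasurable
      (ae_of_all _ fun _ => ENNReal.ofReal_lt_top)]
  congr 2 with x
  rw [enorm_smul, ENNReal.mul_rpow_of_nonneg _ _ hp_pos.le,
    Real.enorm_of_nonneg (Real.rpow_nonneg (hρ0 x) _),
    ENNReal.ofReal_rpow_of_nonneg (Real.rpow_nonneg (hρ0 x) _) hp_pos.le,
    ← Real.rpow_mul (hρ0 x), one_div_mul_cancel hp_pos.ne', Real.rpow_one, Pi.mul_apply]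

theorem eLpNorm_gaussianMeasure {E : Type*} [NormedAddCommGroup E] [NormedSpace ℝ E] {α : ℝ}
    (hα : 0 < α) (f : ℂ → E) {p : ℝ≥0∞} (hp0 : p ≠ 0) (hp : p ≠ ∞) :
    eLpNorm f p (gaussianMeasure α) =
      eLpNorm (fun w => gaussianDensity α w ^ (1 / p.toReal) • f w) p volume :=
  eLpNorm_withDensity_ofReal (continuous_gaussianDensity α).measurable
    (fun w => (gaussianDensity_pos hα w).le) f hp0 hp

theorem gaussianMeasure_ac_gaussianMeasure {α : ℝ} (hα : 0 < α) (γ : ℝ) :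
    gaussianMeasure γ ≪ gaussianMeasure α :=
  (gaussianMeasure_ac γ).trans (ac_gaussianMeasure hα)

theorem gaussianDensity_eq_sqrt_mul_sqrt {α β γ : ℝ} (hβ : 0 < β) (hγ : 0 < γ)
    (hα : β + γ = 2 * α) (w : ℂ) :
    gaussianDensity α w =
      √(α / β) * √(α / γ) * (√(gaussianDensity β w) * √(gaussianDensity γ w)) := by
  have hα0 : 0 < α := by linarith
  have exp_mul_exp : Real.exp (-β * ‖w‖ ^ 2) * Real.exp (-γ * ‖w‖ ^ 2) =
      Real.exp (-α * ‖w‖ ^ 2) ^ 2 := by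
    rw [← Real.exp_add, ← Real.exp_nat_mul]
    congr 1
    push_cast
    linear_combination -‖w‖ ^ 2 * hα
  rw [← Real.sqrt_mul (by positivity), ← Real.sqrt_mul (gaussianDensity_pos hβ w).le,
    ← Real.sqrt_mul (by positivity)]
  refine ((Real.sqrt_eq_iff_eq_sq ?_ (gaussianDensity_pos hα0 w).le).2 ?_).symm
  · have := gaussianDensity_pos hβ w
    have := gaussianDensity_pos hγ w
    positivity
  · simp only [gaussianDensity]
    field_simp
    simpa only [neg_mul] using exp_mul_exp

theorem eLpNorm_mul_le_gaussianMeasure {α β γ : ℝ} (hβ : 0 < β) (hγ : 0 < γ)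
    (hα : β + γ = 2 * α) {f g : ℂ → ℂ} (hf : AEStronglyMeasurable f)
    (hg : AEStronglyMeasurable g) :
    eLpNorm (fun w => f w * g w) 1 (gaussianMeasure α) ≤
      ENNReal.ofReal (√(α / β) * √(α / γ)) *
        (eLpNorm f 2 (gaussianMeasure β) * eLpNorm g 2 (gaussianMeasure γ)) := by
  have hα0 : 0 < α := by linarith
  have measurable_sqrt_smul (δ : ℝ) {h : ℂ → ℂ} (hh : AEStronglyMeasurable h) :
      AEStronglyMeasurable (fun w => √(gaussianDensity δ w) • h w) :=
    (continuous_gaussianDensity δ).sqrt.aestronglyMeasurable.smul hh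
  have split_density : (fun w => gaussianDensity α w • (f w * g w)) =
      (√(α / β) * √(α / γ)) • ((fun w => √(gaussianDensity β w) • f w) •
        fun w => √(gaussianDensity γ w) • g w) := by
    ext w
    simp only [gaussianDensity_eq_sqrt_mul_sqrt hβ hγ hα w, Pi.smul_apply,
      Complex.real_smul, smul_eq_mul, Pi.mul_apply]
    push_cast
    ring
  simp only [eLpNorm_gaussianMeasure hα0 _ one_ne_zero ENNReal.one_ne_top,
    eLpNorm_gaussianMeasure hβ _ two_ne_zero ENNReal.ofNat_ne_top,
    eLpNorm_gaussianMeasure hγ _ two_ne_zero ENNReal.ofNat_ne_top, ENNReal.toReal_one,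
    ENNReal.toReal_ofNat, div_one, Real.rpow_one, ← Real.sqrt_eq_rpow]
  rw [split_density, eLpNorm_const_smul, Real.enorm_of_nonneg (by positivity)]
  gcongr
  exact eLpNorm_smul_le_mul_eLpNorm (measurable_sqrt_smul γ hg) (measurable_sqrt_smul β hf)

end GaussianMeasure

section ReproducingKernel

theorem norm_sq_monomialFun {α : ℝ} (hα : 0 ≤ α) (n : ℕ) (z : ℂ) :
    ‖monomialFun α n z‖ ^ 2 = (α * ‖z‖ ^ 2) ^ n / n.factorial := by
  rw [monomialFun, norm_mul, norm_pow, Complex.norm_real, Real.norm_of_nonneg (Real.sqrt_nonneg _),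
    mul_pow, Real.sq_sqrt (by positivity)]
  ring

theorem hasSum_pow_mul_norm_sq_monomialFun {α : ℝ} (hα : 0 ≤ α) (q : ℝ) (z : ℂ) :
    HasSum (fun n => q ^ n * ‖monomialFun α n z‖ ^ 2) (Real.exp (q * (α * ‖z‖ ^ 2))) := by
  rw [Real.exp_eq_exp_ℝ]
  refine (NormedSpace.expSeries_div_hasSum_exp (q * (α * ‖z‖ ^ 2))).congr_fun fun n => ?_
  rw [norm_sq_monomialFun hα, mul_pow q, mul_div_assoc]

theorem conj_kernelFun (α : ℝ) (z w : ℂ) :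
    conj (kernelFun α z w) = Complex.exp (α * z * conj w) := by
  rw [kernelFun, ← Complex.exp_conj]
  simp only [map_mul, Complex.conj_ofReal, Complex.conj_conj]

theorem iteratedDeriv_kernelFun_zero (α : ℝ) (z : ℂ) (n : ℕ) :
    iteratedDeriv n (kernelFun α z) 0 = (α * conj z) ^ n := by
  refine (congrFun (iteratedDeriv_cexp_const_mul n (α * conj z)) 0).trans ?_
  rw [mul_zero, Complex.exp_zero, mul_one]

theorem kernelFun_eq_kernelFun_div_mul (α : ℝ) {β : ℝ} (hβ : β ≠ 0) (z : ℂ) :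
    kernelFun α z = kernelFun β (α / β * z) := by
  ext w
  simp only [kernelFun, map_mul, map_div₀, Complex.conj_ofReal]
  rw [← mul_assoc, mul_div_cancel₀ _ (Complex.ofReal_ne_zero.2 hβ)]

variable (α : ℝ) [hα : Fact (0 < α)]

theorem integrable_mul_conj_kernelFun {φ : ℂ → ℂ} (hφ : MemLp φ ∞ volume)
    (f : Lp ℂ 2 (gaussianMeasure α)) (z : ℂ) :
    Integrable (fun w => φ w * f w * Complex.exp (α * z * conj w)) (gaussianMeasure α) := by
  have memLp_mul : MemLp (fun w => φ w * f w) 2 (gaussianMeasure α) :=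
    (memLp_congr_ae (coeFn_mulOp α φ hφ f)).1 (Lp.memLp _)
  simpa only [conj_kernelFun, mul_comm] using
    integrable_conj_mul α (memLp_kernelFun hα.out z) memLp_mul

theorem coeFn_kernelVec (z : ℂ) :
    (kernelVec α z : Lp ℂ 2 (gaussianMeasure α)) =ᵐ[gaussianMeasure α] kernelFun α z :=
  (memLp_kernelFun hα.out z).coeFn_toLp

theorem inner_basisVec_kernelVec (n : ℕ) (z : ℂ) :
    inner ℂ (basisVec α n) (kernelVec α z) = conj (monomialFun α n z) := by
  have hα0 : (α : ℂ) ≠ 0 := Complex.ofReal_ne_zero.2 hα.out.ne'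
  have factorial_ne_zero : (n.factorial : ℂ) ≠ 0 := Nat.cast_ne_zero.2 n.factorial_ne_zero
  have hint : Integrable (fun w => conj w ^ n * kernelFun α z w) (gaussianMeasure α) := by
    simpa only [map_pow] using
      integrable_conj_mul α (memLp_pow hα.out n) (memLp_kernelFun hα.out z)
  calc inner ℂ (basisVec α n) (kernelVec α z)
      = ∫ w, conj (monomialFun α n w) * kernelFun α z w ∂gaussianMeasure α :=
        inner_toLp α (memLp_monomialFun hα.out n) (memLp_kernelFun hα.out z)
    _ = √(α ^ n / n.factorial) * ∫ w, conj w ^ n * kernelFun α z w ∂gaussianMeasure α := by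
        simp only [monomialFun, map_mul, map_pow, Complex.conj_ofReal, mul_assoc,
          integral_const_mul]
    _ = conj (monomialFun α n z) := by
        rw [integral_conj_pow_mul hα.out (differentiable_kernelFun α z) n hint,
          iteratedDeriv_kernelFun_zero, monomialFun, map_mul, map_pow, Complex.conj_ofReal,
          mul_pow]
        push_cast
        field_simp

theorem norm_inner_basisVec_kernelVec (n : ℕ) (z : ℂ) :
    ‖inner ℂ (basisVec α n) (kernelVec α z)‖ = ‖monomialFun α n z‖ := by
  rw [inner_basisVec_kernelVec, RCLike.norm_conj]

theorem norm_sq_kernelVec (z : ℂ) : ‖kernelVec α z‖ ^ 2 = Real.exp (α * ‖z‖ ^ 2) := by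
  have parseval := (fockBasis α).hasSum_inner_mul_inner (kernelVec α z) (kernelVec α z)
  have norm_sq_coeff (n : ℕ) : inner ℂ (kernelVec α z) (fockBasis α n) *
      inner ℂ (fockBasis α n) (kernelVec α z) = (‖monomialFun α n z‖ ^ 2 : ℝ) := by
    rw [fockBasis_apply, ← inner_conj_symm (kernelVec α z), RCLike.conj_mul,
      norm_inner_basisVec_kernelVec]
    norm_cast
  simp only [norm_sq_coeff, inner_self_eq_norm_sq_to_K] at parseval
  have hasSum_norm_sq : HasSum (fun n => ‖monomialFun α n z‖ ^ 2) (‖kernelVec α z‖ ^ 2) :=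
    Complex.hasSum_ofReal.1 (by simpa only [Complex.ofReal_pow] using! parseval)
  have hasSum_exp := hasSum_pow_mul_norm_sq_monomialFun hα.out.le 1 z
  simp only [one_pow, one_mul] at hasSum_exp
  exact hasSum_norm_sq.unique hasSum_exp

theorem norm_kernelVec (z : ℂ) : ‖kernelVec α z‖ = Real.exp (α * ‖z‖ ^ 2 / 2) := by
  rw [← Real.sqrt_sq (norm_nonneg _), norm_sq_kernelVec, Real.exp_half]

theorem eLpNorm_kernelFun (α : ℝ) {β : ℝ} (hβ : 0 < β) (z : ℂ) :
    eLpNorm (kernelFun α z) 2 (gaussianMeasure β) =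
      ENNReal.ofReal (Real.exp (α / β * (α * ‖z‖ ^ 2) / 2)) := by
  have : Fact (0 < β) := ⟨hβ⟩
  rw [kernelFun_eq_kernelFun_div_mul α hβ.ne' z,
    ← Lp.enorm_toLp (memLp_kernelFun hβ (α / β * z))]
  change ‖kernelVec β (α / β * z)‖ₑ = _
  rw [← ofReal_norm, norm_kernelVec]
  congr 2
  rw [norm_mul, ← Complex.ofReal_div, Complex.norm_real, mul_pow, Real.norm_eq_abs, sq_abs]
  field_simp

end ReproducingKernel

section Dilation

/-- The function underlying `dilationVec α n`. It does not refer to the measure `λ_α`, so it can be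
compared with the functions `dilationFun γ n` for other Gaussian parameters `γ`. -/
noncomputable def dilationFun (α : ℝ) (n : ℕ) (w : ℂ) : ℂ :=
  if Even n then monomialFun α (n / 2) w else conj (monomialFun α (n / 2 + 1) w)

theorem monomialFun_eq_sqrt_smul {α γ : ℝ} (hα : 0 ≤ α) (hγ : 0 < γ) (n : ℕ) (w : ℂ) :
    monomialFun α n w = √((α / γ) ^ n) • monomialFun γ n w := by
  rw [monomialFun, monomialFun, Complex.real_smul, ← mul_assoc, ← Complex.ofReal_mul,
    ← Real.sqrt_mul (by positivity)]
  congr 4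
  rw [← mul_div_assoc, ← mul_pow, div_mul_cancel₀ _ hγ.ne']

theorem dilationFun_eq_sqrt_smul {α γ : ℝ} (hα : 0 ≤ α) (hγ : 0 < γ) (n : ℕ) (w : ℂ) :
    dilationFun α n w = √((α / γ) ^ ((n + 1) / 2)) • dilationFun γ n w := by
  -- Both `n / 2` for `n` even and `n / 2 + 1` for `n` odd are equal to `(n + 1) / 2`.
  rw [dilationFun, dilationFun]
  split_ifs with hn
  · rw [Nat.succ_div_of_not_dvd (Nat.two_dvd_ne_zero.2 (Nat.odd_iff.1 hn.add_one)),
      monomialFun_eq_sqrt_smul hα hγ]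
  · rw [Nat.succ_div_of_dvd (Nat.not_even_iff_odd.1 hn).add_one.two_dvd,
      monomialFun_eq_sqrt_smul hα hγ, Complex.real_smul, Complex.real_smul, map_mul,
      Complex.conj_ofReal]

variable (α : ℝ) [hα : Fact (0 < α)]

theorem coeFn_dilationVec (n : ℕ) : dilationVec α n =ᵐ[gaussianMeasure α] dilationFun α n := by
  unfold dilationVec dilationFun
  split_ifs
  · exact (memLp_monomialFun hα.out (n / 2)).coeFn_toLp
  · exact (memLp_conj α (memLp_monomialFun hα.out (n / 2 + 1))).coeFn_toLp

theorem coeFn_sum_smul_dilationVec (s : Finset ℕ) (c : ℕ → ℂ) :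
    (∑ n ∈ s, c n • dilationVec α n : Lp ℂ 2 (gaussianMeasure α)) =ᵐ[gaussianMeasure α]
      fun w => ∑ n ∈ s, c n • dilationFun α n w := by
  have coeFn_all : ∀ᵐ w ∂gaussianMeasure α, ∀ n,
      (c n • dilationVec α n : Lp ℂ 2 (gaussianMeasure α)) w = c n • dilationFun α n w := by
    refine ae_all_iff.2 fun n => ?_
    filter_upwards [Lp.coeFn_smul (c n) (dilationVec α n), coeFn_dilationVec α n] with w h₁ h₂
    rw [h₁, Pi.smul_apply, h₂]
  filter_upwards [Lp.coeFn_finsetSum s fun n => c n • dilationVec α n, coeFn_all] with w h₁ h₂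
  simp only [h₁, Finset.sum_apply, h₂]

theorem eLpNorm_sum_smul_dilationFun (s : Finset ℕ) (c : ℕ → ℂ) :
    eLpNorm (fun w => ∑ n ∈ s, c n • dilationFun α n w) 2 (gaussianMeasure α) =
      ENNReal.ofReal √(∑ n ∈ s, ‖c n‖ ^ 2) := by
  rw [← eLpNorm_congr_ae (coeFn_sum_smul_dilationVec α s c), ← Lp.enorm_def, ← ofReal_norm,
    ← Real.sqrt_sq (norm_nonneg _), @norm_sq_eq_re_inner ℂ, (orthonormal_dilationVec α).inner_sum]
  simp only [RCLike.conj_mul, ← RCLike.ofReal_pow, ← RCLike.ofReal_sum, RCLike.ofReal_re]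

theorem eLpNorm_dilation_le {γ : ℝ} (hγ : 0 < γ) (f : fockSpace α)
    (hf : Summable fun n => (α / γ) ^ ((n + 1) / 2) * ‖inner ℂ (basisVec α n) f‖ ^ 2) :
    eLpNorm (dilation α f) 2 (gaussianMeasure γ) ≤
      ENNReal.ofReal √(∑' n, (α / γ) ^ ((n + 1) / 2) * ‖inner ℂ (basisVec α n) f‖ ^ 2) := by
  have : Fact (0 < γ) := ⟨hγ⟩
  have hαγ : 0 ≤ α / γ := (div_pos hα.out hγ).le
  have ae_le := (gaussianMeasure_ac_gaussianMeasure hα.out γ).ae_le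
  have hasSum_dilation : HasSum (fun n => inner ℂ (basisVec α n) f • dilationVec α n)
      (dilation α f) := by
    simpa only [HilbertBasis.repr_apply_apply, fockBasis_apply, map_smul, dilation_basisVec] using
      ((fockBasis α).hasSum_repr f).mapL (dilation α)
  obtain ⟨N, -, tendsto_ae⟩ :=
    (tendstoInMeasure_of_tendsto_Lp hasSum_dilation.tendsto_sum_nat).exists_seq_tendsto_ae
  refine Lp.eLpNorm_le_of_ae_tendsto (Eventually.of_forall fun k => ?_)
    (fun k => (Lp.aestronglyMeasurable _).mono_ac
      (gaussianMeasure_ac_gaussianMeasure hα.out γ)) (ae_le tendsto_ae)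
  rw [eLpNorm_congr_ae (ae_le (coeFn_sum_smul_dilationVec α _ _))]
  simp only [dilationFun_eq_sqrt_smul hα.out.le hγ, smul_comm (inner ℂ (basisVec α _) f)]
  simp only [← smul_assoc, eLpNorm_sum_smul_dilationFun]
  refine ENNReal.ofReal_le_ofReal (Real.sqrt_le_sqrt ?_)
  simp only [norm_smul, mul_pow, Real.norm_of_nonneg (Real.sqrt_nonneg _),
    Real.sq_sqrt (pow_nonneg hαγ _)]
  exact hf.sum_le_tsum _ fun n _ => by positivity

theorem eLpNorm_dilation_kernelVec_le {q : ℝ} (hq : 1 ≤ q) (z : ℂ) :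
    eLpNorm (dilation α (kernelVec α z)) 2 (gaussianMeasure (α / q ^ 2)) ≤
      ENNReal.ofReal √(q * Real.exp (q * (α * ‖z‖ ^ 2))) := by
  have hα0 := hα.out
  have hq0 : 0 < q := by linarith
  have coeff_le (n : ℕ) : (α / (α / q ^ 2)) ^ ((n + 1) / 2) * ‖monomialFun α n z‖ ^ 2 ≤
      q * (q ^ n * ‖monomialFun α n z‖ ^ 2) := by
    rw [div_div_cancel₀ hα0.ne', ← pow_mul, ← mul_assoc, ← pow_succ']
    gcongr
    exact Nat.mul_div_le (n + 1) 2
  have hasSum_bound := (hasSum_pow_mul_norm_sq_monomialFun hα0.le q z).mul_left q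
  have summable_coeff := hasSum_bound.summable.of_nonneg_of_le (fun n => by positivity) coeff_le
  simp only [← norm_inner_basisVec_kernelVec] at summable_coeff coeff_le hasSum_bound
  refine (eLpNorm_dilation_le α (div_pos hα0 (pow_pos hq0 2)) _ summable_coeff).trans
    (ENNReal.ofReal_le_ofReal (Real.sqrt_le_sqrt ?_))
  exact (hasSum_bound.tsum_eq ▸ summable_coeff.tsum_le_tsum coeff_le hasSum_bound.summable :)

end Dilation

section Berezin

variable (α : ℝ) {φ : ℂ → ℂ} (hφ : MemLp φ ∞ volume)

theorem enorm_inner_mulOp_le_eLpNorm_mul (f g : Lp ℂ 2 (gaussianMeasure α)) :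
    ‖inner ℂ g (mulOp α φ hφ f)‖ₑ ≤
      eLpNorm φ ∞ volume * eLpNorm (fun w => g w * f w) 1 (gaussianMeasure α) := by
  have enorm_inner_ae : (fun w => ‖inner ℂ (g w) (mulOp α φ hφ f w)‖ₑ) =ᵐ[gaussianMeasure α]
      fun w => ‖φ w • (g w * f w)‖ₑ := by
    filter_upwards [coeFn_mulOp α φ hφ f] with w hw
    rw [hw, RCLike.inner_apply, smul_eq_mul, enorm_mul, enorm_mul, enorm_mul, enorm_mul,
      RCLike.enorm_conj]
    ring
  calc ‖inner ℂ g (mulOp α φ hφ f)‖ₑ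
      ≤ ∫⁻ w, ‖inner ℂ (g w) (mulOp α φ hφ f w)‖ₑ ∂gaussianMeasure α := by
        rw [L2.inner_def]
        exact enorm_integral_le_lintegral_enorm _
    _ = eLpNorm (φ • fun w => g w * f w) 1 (gaussianMeasure α) := by
        rw [lintegral_congr_ae enorm_inner_ae, eLpNorm_one_eq_lintegral_enorm]
        rfl
    _ ≤ eLpNorm φ ∞ (gaussianMeasure α) * eLpNorm (fun w => g w * f w) 1 (gaussianMeasure α) :=
        eLpNorm_smul_le_eLpNorm_top_mul_eLpNorm 1
          ((Lp.aestronglyMeasurable g).mul (Lp.aestronglyMeasurable f)) φ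
    _ ≤ eLpNorm φ ∞ volume * eLpNorm (fun w => g w * f w) 1 (gaussianMeasure α) := by
        gcongr ?_ * _
        simpa only [eLpNorm_exponent_top] using
          eLpNormEssSup_mono_measure φ (gaussianMeasure_ac α)

theorem enorm_inner_mulOp_le {β γ : ℝ} (hβ : 0 < β) (hγ : 0 < γ) (hα : β + γ = 2 * α)
    (f g : Lp ℂ 2 (gaussianMeasure α)) :
    ‖inner ℂ g (mulOp α φ hφ f)‖ₑ ≤
      eLpNorm φ ∞ volume * (ENNReal.ofReal (√(α / β) * √(α / γ)) *
        (eLpNorm g 2 (gaussianMeasure β) * eLpNorm f 2 (gaussianMeasure γ))) := by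
  have hα0 : 0 < α := by linarith
  refine (enorm_inner_mulOp_le_eLpNorm_mul α hφ f g).trans ?_
  gcongr
  exact eLpNorm_mul_le_gaussianMeasure hβ hγ hα
    ((Lp.aestronglyMeasurable g).mono_ac (ac_gaussianMeasure hα0))
    ((Lp.aestronglyMeasurable f).mono_ac (ac_gaussianMeasure hα0))

variable [hα : Fact (0 < α)]

theorem enorm_inner_kernelVec_mulOp_dilation_le {β q : ℝ} (hβ : 0 < β) (hq : 1 ≤ q)
    (hβq : β + α / q ^ 2 = 2 * α) (z : ℂ) :
    ‖inner ℂ (kernelVec α z : Lp ℂ 2 (gaussianMeasure α))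
        (mulOp α φ hφ (dilation α (kernelVec α z)))‖ₑ ≤
      eLpNorm φ ∞ volume * (ENNReal.ofReal (√(α / β) * q) *
        (ENNReal.ofReal (Real.exp (α / β * (α * ‖z‖ ^ 2) / 2)) *
          ENNReal.ofReal √(q * Real.exp (q * (α * ‖z‖ ^ 2))))) := by
  have hq0 : 0 < q := by linarith
  refine (enorm_inner_mulOp_le α hφ hβ (div_pos hα.out (pow_pos hq0 2)) hβq _ _).trans ?_
  rw [eLpNorm_congr_ae
      ((gaussianMeasure_ac_gaussianMeasure hα.out β).ae_le (coeFn_kernelVec α z)),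
    eLpNorm_kernelFun α hβ, div_div_cancel₀ hα.out.ne', Real.sqrt_sq hq0.le]
  gcongr
  exact eLpNorm_dilation_kernelVec_le α hq z

theorem norm_inner_kernelVec_mulOp_dilation_le {β q : ℝ} (hβ : 0 < β) (hq : 1 ≤ q)
    (hβq : β + α / q ^ 2 = 2 * α) (z : ℂ) :
    ‖inner ℂ (kernelVec α z : Lp ℂ 2 (gaussianMeasure α))
        (mulOp α φ hφ (dilation α (kernelVec α z)))‖ ≤
      (eLpNorm φ ∞ volume).toReal * (√(α / β) * q * √q) *
        Real.exp ((α / β + q) / 2 * (α * ‖z‖ ^ 2)) := by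
  have hq0 : 0 ≤ q := by linarith
  have enorm_le := enorm_inner_kernelVec_mulOp_dilation_le α hφ hβ hq hβq z
  rw [← ENNReal.ofReal_toReal hφ.2.ne, ← ENNReal.ofReal_mul (Real.exp_pos _).le,
    ← ENNReal.ofReal_mul (mul_nonneg (Real.sqrt_nonneg _) hq0),
    ← ENNReal.ofReal_mul ENNReal.toReal_nonneg, ← ofReal_norm,
    ENNReal.ofReal_le_ofReal_iff (by positivity)] at enorm_le
  refine enorm_le.trans_eq ?_
  have exp_split : Real.exp ((α / β + q) / 2 * (α * ‖z‖ ^ 2)) =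
      Real.exp (α / β * (α * ‖z‖ ^ 2) / 2) * Real.exp (q * (α * ‖z‖ ^ 2) / 2) := by
    rw [← Real.exp_add]
    ring_nf
  rw [exp_split, Real.sqrt_mul hq0, ← Real.exp_half]
  ring

theorem inner_kernelVec_mulOp (f : Lp ℂ 2 (gaussianMeasure α)) (z : ℂ) :
    inner ℂ (kernelVec α z : Lp ℂ 2 (gaussianMeasure α)) (mulOp α φ hφ f) =
      ∫ w, φ w * f w * Complex.exp (α * z * conj w) ∂gaussianMeasure α := by
  rw [L2.inner_def]
  refine integral_congr_ae ?_
  filter_upwards [coeFn_kernelVec α z, coeFn_mulOp α φ hφ f] with w hK hφf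
  rw [hK, hφf, RCLike.inner_apply, conj_kernelFun]

theorem normKernelVec_eq_exp_smul (z : ℂ) :
    normKernelVec α z = (Real.exp (-(α * ‖z‖ ^ 2 / 2)) : ℂ) • kernelVec α z := by
  rw [normKernelVec, norm_kernelVec, Real.exp_neg, Complex.ofReal_inv]

theorem berezin_hToeplitz (z : ℂ) :
    berezin α (hToeplitz α φ hφ) z = Complex.exp (-(α * (‖z‖ : ℂ) ^ 2 / 2)) *
      inner ℂ (kernelVec α z : Lp ℂ 2 (gaussianMeasure α))
        (mulOp α φ hφ (dilation α (normKernelVec α z))) := by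
  refine ((fockSpace α).inner_orthogonalProjectionOnto_eq_of_mem_left _ _).trans ?_
  conv_lhs => enter [2]; rw [normKernelVec_eq_exp_smul]
  rw [Submodule.coe_smul, inner_smul_left, Complex.conj_ofReal]
  push_cast
  rfl

theorem norm_berezin_hToeplitz_le {β q : ℝ} (hβ : 0 < β) (hq : 1 ≤ q)
    (hβq : β + α / q ^ 2 = 2 * α) (z : ℂ) :
    ‖berezin α (hToeplitz α φ hφ) z‖ ≤
      (eLpNorm φ ∞ volume).toReal * (√(α / β) * q * √q) *
        Real.exp (((α / β + q) / 2 - 1) * (α * ‖z‖ ^ 2)) := by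
  have norm_cexp : ‖Complex.exp (-(α * (‖z‖ : ℂ) ^ 2 / 2))‖ = Real.exp (-(α * ‖z‖ ^ 2 / 2)) := by
    rw [← Complex.norm_exp_ofReal]
    push_cast
    rfl
  have exp_mul_exp : Real.exp (-(α * ‖z‖ ^ 2 / 2)) * Real.exp (-(α * ‖z‖ ^ 2 / 2)) =
      Real.exp (-(α * ‖z‖ ^ 2)) := by
    rw [← Real.exp_add, ← neg_add, add_halves]
  rw [berezin_hToeplitz, normKernelVec_eq_exp_smul, map_smul, map_smul, inner_smul_right, norm_mul,
    norm_mul, norm_cexp, Complex.norm_real, Real.norm_of_nonneg (Real.exp_pos _).le, ← mul_assoc,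
    exp_mul_exp, sub_one_mul, sub_eq_neg_add _ (α * ‖z‖ ^ 2), Real.exp_add, mul_left_comm]
  gcongr
  exact norm_inner_kernelVec_mulOp_dilation_le α hφ hβ hq hβq z

theorem tendsto_berezin_hToeplitz :
    Tendsto (berezin α (hToeplitz α φ hφ)) (cocompact ℂ) (𝓝 0) := by
  have hα0 : 0 < α := hα.out
  -- The rate `(α / β + q) / 2 - 1` is negative for `1 < q < (1 + √17) / 4`.
  have norm_le := norm_berezin_hToeplitz_le α hφ (β := 34 / 25 * α) (q := 5 / 4) (by positivity)
    (by norm_num) (by ring)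
  have rate_neg : (α / (34 / 25 * α) + 5 / 4) / 2 - 1 < 0 := by
    field_simp
    norm_num
  have tendsto_mul_norm_sq : Tendsto (fun z : ℂ => α * ‖z‖ ^ 2) (cocompact ℂ) atTop :=
    ((tendsto_pow_atTop two_ne_zero).comp tendsto_norm_cocompact_atTop).const_mul_atTop hα0
  have tendsto_exp :=
    Real.tendsto_exp_atBot.comp (tendsto_mul_norm_sq.const_mul_atTop_of_neg rate_neg)
  exact squeeze_zero_norm norm_le (by simpa only [mul_zero] using! tendsto_exp.const_mul _)

end Berezin

end HToeplitz

theorem mainTheorem5 (α : ℝ) [Fact (0 < α)] (φ : ℂ → ℂ) (hφ : MemLp φ ∞ (volume : Measure ℂ)) :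
    (∀ z : ℂ,
      Integrable
        (fun w : ℂ => φ w * HToeplitz.dilatedKernel α z w * Complex.exp (α * z * conj w))
        (HToeplitz.gaussianMeasure α) ∧
      HToeplitz.berezin α (HToeplitz.hToeplitz α φ hφ) z =
        Complex.exp (-(α * (‖z‖ : ℂ) ^ 2 / 2)) *
          ∫ w : ℂ, φ w * HToeplitz.dilatedKernel α z w * Complex.exp (α * z * conj w)
            ∂HToeplitz.gaussianMeasure α) ∧
    Tendsto (HToeplitz.berezin α (HToeplitz.hToeplitz α φ hφ)) (cocompact ℂ) (𝓝 0) :=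
  ⟨fun z => ⟨HToeplitz.integrable_mul_conj_kernelFun α hφ _ z, by
      rw [HToeplitz.berezin_hToeplitz, HToeplitz.inner_kernelVec_mulOp]
      rfl⟩,
    HToeplitz.tendsto_berezin_hToeplitz α hφ⟩
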